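/- Let $\lambda\in\mathbb R$. For $\omega=(\omega_1,\omega_2)\in S^1$ put $\omega^\perp=(-\omega_2,\omega_1)$, and for $p\in\mathbb R$ let $l(\omega,p)=\{x\in\mathbb R^2:\langle x,\omega\rangle=p\}$ and $$R_\lambda f(\omega,p)=\int_{-\infty}^{\infty}e^{-\lambda u}f(p\omega+u\omega^\perp)\,du .$$ Let $K\subset\mathbb R^2$ be closed and convex (possibly empty or unbounded), let $\Omega\subset S^1$ be perfect in the sense that every point of $\Omega$ is a limit point of $\Omega$, and let $K^\#$ be the union of all lines $l(\omega,p)$ with $\omega\in\Omega$ and $l(\omega,p)\cap K=\emptyset$. Write $P_\omega=\{p\in\mathbb R: l(\omega,p)\cap K=\emptyset\}$. Assume moreover that for every $p$ the set $\{\omega\in\Omega: p\in P_\omega\}$ has no isolated points (this is automatic if $K$ is bounded, or if $\Omega$ is open in $S^1$ and $K$ contains no line). Let $f:\mathbb R^2\to\mathbb R$ be continuous, and suppose that $f$ satisfies the following conditions for every $\omega_0\in\Omega$. (a) $f$ is continuously differentiable on $K^\#$. (b) For every $p\in P_{\omega_0}$ and $k\in\mathbb N$ there are $\varepsilon>0$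 and $c<\infty$ such that $\int_{-\infty}^\infty|u^k e^{-\lambda u} f(p'\omega+u\omega^\perp)|\,du<c$ for all $\omega\in\Omega$ and $p'\in P_\omega$ with $|\omega-\omega_0|<\varepsilon$ and $|p'-p|<\varepsilon$. (c) The same holds with the directional derivative $(\partial_\omega f)(p'\omega+u\omega^\perp)$ in place of $f(p'\omega+u\omega^\perp)$. (d) For every $p\in P_{\omega_0}$ there is $\mu>0$ with $\int_{-\infty}^\infty|e^{-\lambda u}f(p\omega_0+u\omega_0^\perp)|\,e^{\mu|u|}\,du<\infty$. (e) For every connected component $I$ of $P_{\omega_0}$ and every $k\in\mathbb N$, the moment $M_k(q)=\int_{-\infty}^\infty u^k e^{-\lambda u}f(q\omega_0+u\omega_0^\perp)\,du$ either vanishes for some $q\in I$, or there is a sequence $q_j\in I$ tending to $+\infty$ or to $-\infty$ such that $\limsup_j\int_{-\infty}^\infty|u^k e^{-\lambda u}f(q_j\omega_0+u\omega_0^\perp)|\,du<\infty$ and $M_k(q_j)\to0$. If $R_\lambda f(\omega,p)=0$ for all $\omega\in\Omega$ and $p\in\mathbb R$ with $l(\omega,p)\cap K=\emptyset$, then $f\equiv0$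 on $K^\#$. -/

import Mathlib

open Set Filter Topology MeasureTheory

noncomputable section

namespace ExpRadon

/-- The Euclidean plane. -/
abbrev Plane : Type := EuclideanSpace ℝ (Fin 2)

/-- Rotation by a right angle: `(cos t, sin t)` goes to `(-sin t, cos t)`. -/
def perp (ω : Plane) : Plane := !₂[-ω 1, ω 0]

/-- The line `l(ω, p) = {x | ⟨x, ω⟩ = p}`. -/
def line (ω : Plane) (p : ℝ) : Set Plane := {x | inner ℝ x ω = p}

/-- The point `p ω + u ω^⊥`; for a unit vector `ω`, these are the points of `l(ω, p)`,
parametrized by arc length `u`. -/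
def pt (ω : Plane) (p u : ℝ) : Plane := p • ω + u • perp ω

/-- The parameters `p` of the lines with normal vector `ω` that avoid `K`. -/
def avoiding (K : Set Plane) (ω : Plane) : Set ℝ := {p | Disjoint (line ω p) K}

/-- The union of all lines that avoid `K` and have their normal vector in `Ω`. -/
def sharp (K Ω : Set Plane) : Set Plane := ⋃ ω ∈ Ω, ⋃ p ∈ avoiding K ω, line ω p

/-- The moments of the exponential Radon transform,
`∫ u^k e^{-lam u} f(p ω + u ω^⊥) du`. -/
def radonMoment (lam : ℝ) (k : ℕ) (f : Plane → ℝ) (ω : Plane) (p : ℝ) : ℝ :=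
  ∫ u : ℝ, u ^ k * (Real.exp (-(lam * u)) * f (pt ω p u))

/-- The exponential Radon transform `∫ e^{-lam u} f(p ω + u ω^⊥) du`. -/
def radon (lam : ℝ) (f : Plane → ℝ) (ω : Plane) (p : ℝ) : ℝ :=
  ∫ u : ℝ, Real.exp (-(lam * u)) * f (pt ω p u)

/-- The functions `g ω : Plane → ℝ`, multiplied by the weight `e^{-lam u}` of the exponential
Radon transform, decay faster than every polynomial in the integral sense along the lines
`l(ω, p)` that avoid `K` with `ω ∈ Ω`, locally uniformly in `p` and in `ω` near `ω₀`. -/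
def RapidDecay (lam : ℝ) (K Ω : Set Plane) (g : Plane → Plane → ℝ) (ω₀ : Plane) : Prop :=
  ∀ p ∈ avoiding K ω₀, ∀ k : ℕ, ∃ ε > (0 : ℝ), ∃ c : ℝ,
    ∀ ω ∈ Ω, dist ω ω₀ < ε → ∀ p' ∈ avoiding K ω, |p' - p| < ε →
      Integrable (fun u : ℝ => u ^ k * (Real.exp (-(lam * u)) * g ω (pt ω p' u))) ∧
      ∫ u : ℝ, |u ^ k * (Real.exp (-(lam * u)) * g ω (pt ω p' u))| < c

/-- The regularity and decay conditions at the direction `ω₀`, on the lines that avoid `K` and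
have their normal vector in `Ω`. -/
structure DecayClass (lam : ℝ) (K Ω : Set Plane) (f : Plane → ℝ) (ω₀ : Plane) : Prop where
  /-- `f` is continuously differentiable on the union of the lines. -/
  differentiableAt : ∀ x ∈ sharp K Ω, DifferentiableAt ℝ f x
  continuousOn_fderiv : ContinuousOn (fderiv ℝ f) (sharp K Ω)
  /-- `f` decays faster than every polynomial. -/
  decay : RapidDecay lam K Ω (fun _ x => f x) ω₀
  /-- The directional derivative in the direction `ω` decays faster than every polynomial. -/
  decay_deriv : RapidDecay lam K Ω (fun ω x => fderiv ℝ f x ω) ω₀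
  /-- The integrand of the transform decays exponentially on each line normal to `ω₀`. -/
  exp_decay : ∀ p ∈ avoiding K ω₀, ∃ μ > (0 : ℝ),
    Integrable (fun u : ℝ => |Real.exp (-(lam * u)) * f (pt ω₀ p u)| * Real.exp (μ * |u|))
  /-- In each family of parallel lines normal to `ω₀` on one side of `K`, each moment vanishes on
  some line, or tends to zero, with bounded absolute moments, along lines going to infinity.
  The condition on `uIcc` says that the lines with parameters `p` and `q` are on the same side. -/
  moments : ∀ p ∈ avoiding K ω₀, ∀ k : ℕ,
    (∃ q : ℝ, uIcc p q ⊆ avoiding K ω₀ ∧ radonMoment lam k f ω₀ q = 0) ∨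
    (∃ q : ℕ → ℝ, (∀ j, uIcc p (q j) ⊆ avoiding K ω₀) ∧
      (Tendsto q atTop atTop ∨ Tendsto q atTop atBot) ∧
      (∃ C : ℝ, ∀ᶠ j in atTop,
        ∫ u : ℝ, |u ^ k * (Real.exp (-(lam * u)) * f (pt ω₀ (q j) u))| ≤ C) ∧
      Tendsto (fun j => radonMoment lam k f ω₀ (q j)) atTop (𝓝 0))

end ExpRadon

end

noncomputable section

namespace ExpRadon

/-! On a line with normal `ω`, write `M_k(ω, p)` for the moment of order `k` of `e^{-lam u} f`. The
core is that all `M_k` vanish on every line avoiding `K` with normal in `Ω`. A continuous function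
with exponential decay is determined by its moments (`eq_zero_of_moments`), so `f` vanishes on each
such line.

The moments are killed by induction on `k`. Put `w(u) = u^k e^{-lam u}`, let `φ` be a `C¹` bump in
`p`, and integrate `φ(⟨x, ω⟩) w(⟨x, ω^⊥⟩) f(x)` over the plane. By Fubini this is `∫ φ(p) M_k(ω, p)
dp`, which is zero for all `ω ∈ Ω` near `ω₀` whose strip avoids `K`. Rotating `ω` moves `⟨x, ω⟩` at
rate `u` and `⟨x, ω^⊥⟩` at rate `-p`, so differentiating at `ω₀` gives `∫ φ' M_{k+1} dp - ∫ p φ(p)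
(∫ w' f du) dp = 0`. As `w'` only involves orders `k - 1` and `k`, the second integral vanishes.
Hence `M_{k+1}` has zero weak derivative in `p` and is constant on each side of `K`
(`radonMoment_succ_eq`); condition (e) makes the constant zero.

The derivative falls on `φ` and `w`, never on `f`, and a difference quotient along any directions
accumulating at `ω₀` suffices; `accPt_strip` supplies them. The analytic work is the passage to the
limit, `integral_deriv_mul_moment_eq_zero`. -/

/-! ### Determinacy of the moment problem under exponential decay -/

open ProbabilityTheory in
/-- Two finite measures on the line with exponential moments near `0` and the same moments
are equal. -/
theorem measure_ext_of_moments {μ ν : Measure ℝ} [IsFiniteMeasure μ] [IsFiniteMeasure ν]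
    (hμ : (0 : ℝ) ∈ interior (integrableExpSet id μ))
    (hν : (0 : ℝ) ∈ interior (integrableExpSet id ν))
    (h : ∀ n : ℕ, ∫ x, x ^ n ∂μ = ∫ x, x ^ n ∂ν) : μ = ν := by
  -- A vertical strip containing `0` and the imaginary axis. Both complex moment generating
  -- functions are analytic on it and their Taylor coefficients at `0` are the moments; on the
  -- imaginary axis they are the characteristic functions.
  set S : Set ℂ := {z | z.re ∈ interior (integrableExpSet id μ) ∩ interior (integrableExpSet id ν)}
  have hSpre : IsPreconnected S := by
    refine (Convex.isPreconnected ?_)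
    have hc : Convex ℝ (interior (integrableExpSet (id : ℝ → ℝ) μ) ∩
        interior (integrableExpSet (id : ℝ → ℝ) ν)) :=
      (convex_integrableExpSet.interior).inter (convex_integrableExpSet.interior)
    exact hc.linear_preimage Complex.reLm
  have h1 : AnalyticOnNhd ℂ (complexMGF id μ) S := fun z hz => analyticOnNhd_complexMGF z hz.1
  have h2 : AnalyticOnNhd ℂ (complexMGF id ν) S := fun z hz => analyticOnNhd_complexMGF z hz.2
  have h0 : (0 : ℂ) ∈ S := ⟨by simpa using hμ, by simpa using hν⟩
  have hD : ∀ n, iteratedDeriv n (complexMGF id μ) 0 = iteratedDeriv n (complexMGF id ν) 0 := by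
    intro n
    rw [iteratedDeriv_complexMGF (by simpa using hμ), iteratedDeriv_complexMGF (by simpa using hν)]
    simp only [id, zero_mul, Complex.exp_zero, mul_one]
    have := congrArg (fun r : ℝ => (r : ℂ)) (h n)
    simp only [← integral_complex_ofReal] at this
    simpa using this
  have hev : complexMGF id μ =ᶠ[𝓝 0] complexMGF id ν := by
    have h3 := (h1 0 h0).hasFPowerSeriesAt
    have h4 := (h2 0 h0).hasFPowerSeriesAt
    simp only [hD] at h3
    filter_upwards [h3.eventually_hasSum_sub, h4.eventually_hasSum_sub] with z hz hz'
    exact hz.unique hz'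
  have heq := h1.eqOn_of_preconnected_of_eventuallyEq h2 hSpre h0 hev
  refine Measure.ext_of_charFun ?_
  ext t
  rw [← complexMGF_id_mul_I, ← complexMGF_id_mul_I]
  exact heq ⟨by simpa using hμ, by simpa using hν⟩

open ProbabilityTheory in
theorem zero_mem_interior_integrableExpSet_withDensity {h : ℝ → ℝ} (hh : Continuous h) {μ : ℝ}
    (hμ : 0 < μ) (hint : Integrable fun u => |h u| * Real.exp (μ * |u|)) :
    (0 : ℝ) ∈ interior
      (integrableExpSet id (volume.withDensity fun u => ENNReal.ofReal (h u))) := by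
  rw [mem_interior]
  refine ⟨Ioo (-μ) μ, fun t ht => ?_, isOpen_Ioo, by simpa using hμ⟩
  rw [integrableExpSet, mem_ofPred_eq,
    integrable_withDensity_iff (hh.measurable.ennreal_ofReal) (by simp)]
  refine hint.mono' (Measurable.aestronglyMeasurable (by simp only [id]; fun_prop))
    (Eventually.of_forall fun u => ?_)
  have h1 : |t * u| ≤ μ * |u| := by
    rw [abs_mul]; gcongr; exact (abs_lt.2 ht).le
  rw [Real.norm_eq_abs, abs_mul, abs_of_pos (Real.exp_pos _), mul_comm, ENNReal.toReal_ofReal',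
    abs_of_nonneg (le_max_right _ _)]
  exact mul_le_mul (max_le (le_abs_self _) (abs_nonneg _))
    (Real.exp_le_exp.2 ((le_abs_self _).trans h1)) (Real.exp_pos _).le (abs_nonneg _)

/-- A continuous exponentially decaying function all of whose moments vanish is zero. -/
theorem eq_zero_of_moments {h : ℝ → ℝ} (hh : Continuous h) {μ : ℝ} (hμ : 0 < μ)
    (hint : Integrable fun u => |h u| * Real.exp (μ * |u|))
    (hpow : ∀ k : ℕ, Integrable fun u => u ^ k * h u)
    (hmom : ∀ k : ℕ, ∫ u, u ^ k * h u = 0) (u : ℝ) : h u = 0 := by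
  have hi : Integrable h := by simpa using hpow 0
  have hi' : Integrable fun u => -h u := hi.neg
  have f1 : IsFiniteMeasure (volume.withDensity fun u => ENNReal.ofReal (h u)) :=
    isFiniteMeasure_withDensity_ofReal hi.2
  have f2 : IsFiniteMeasure (volume.withDensity fun u => ENNReal.ofReal (-h u)) :=
    isFiniteMeasure_withDensity_ofReal hi'.2
  have hh' : Continuous fun u => -h u := hh.neg
  -- The two measures have the positive and the negative part of `h` as densities; the difference of
  -- their moments is the moment of `h`.
  have key := measure_ext_of_moments
    (zero_mem_interior_integrableExpSet_withDensity hh hμ hint)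
    (zero_mem_interior_integrableExpSet_withDensity hh' hμ (by simpa using hint)) (fun n => by
      rw [integral_withDensity_eq_integral_toReal_smul hh.measurable.ennreal_ofReal (by simp),
        integral_withDensity_eq_integral_toReal_smul hh'.measurable.ennreal_ofReal (by simp),
        ← sub_eq_zero, ← integral_sub]
      · rw [← hmom n]
        congr 1; ext x
        simp only [ENNReal.toReal_ofReal', smul_eq_mul]
        rw [← sub_mul, mul_comm]
        congr 1
        rcases le_total (h x) 0 with hx | hx <;> simp [hx]
      all_goals
        refine (hpow n).mono (Measurable.aestronglyMeasurable (by fun_prop)) (Eventually.of_forall fun x => ?_)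
        simp only [ENNReal.toReal_ofReal', smul_eq_mul, norm_mul, Real.norm_eq_abs]
        have habs (y : ℝ) : |max y 0| = max y 0 := abs_of_nonneg (le_max_right _ _)
        rw [mul_comm, habs]
        refine mul_le_mul_of_nonneg_left ?_ (abs_nonneg _)
        first
        | exact max_le (le_abs_self _) (abs_nonneg _)
        | exact max_le (neg_le_abs _) (abs_nonneg _))
  have hae : h =ᵐ[volume] 0 := by
    have := (withDensity_eq_iff hh.measurable.ennreal_ofReal.aemeasurable
      hh'.measurable.ennreal_ofReal.aemeasurable
      (by exact hi.lintegral_lt_top.ne)).1 key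
    filter_upwards [this] with x hx
    rcases le_total (h x) 0 with h0 | h0
    · rw [ENNReal.ofReal_of_nonpos h0] at hx
      have := ENNReal.ofReal_eq_zero.1 hx.symm
      simp; linarith
    · rw [ENNReal.ofReal_of_nonpos (p := -h x) (by linarith)] at hx
      have := ENNReal.ofReal_eq_zero.1 hx
      simp; linarith
  exact congrFun ((hh.ae_eq_iff_eq volume continuous_zero).1 hae) u

/-! ### Coordinates `(p, u)` attached to a direction, and Fubini on strips -/

theorem inner_eq (x y : Plane) : inner ℝ x y = x 0 * y 0 + x 1 * y 1 := by
  simp [PiLp.inner_apply, Fin.sum_univ_two, mul_comm]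

theorem inner_perp (x y : Plane) : inner ℝ x (perp y) = x 1 * y 0 - x 0 * y 1 := by
  simp [inner_eq, perp]; ring

theorem pt_zero (ω : Plane) (p u : ℝ) : pt ω p u 0 = p * ω 0 - u * ω 1 := by
  simp [pt, perp]; ring

theorem pt_one (ω : Plane) (p u : ℝ) : pt ω p u 1 = p * ω 1 + u * ω 0 := by
  simp [pt, perp]

theorem sq_add_sq {ω : Plane} (hω : ω ∈ Metric.sphere (0 : Plane) 1) :
    ω 0 ^ 2 + ω 1 ^ 2 = 1 := by
  have h : ‖ω‖ ^ 2 = 1 := by simp [mem_sphere_zero_iff_norm.1 hω]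
  rw [EuclideanSpace.norm_sq_eq] at h
  simpa [Fin.sum_univ_two] using h

theorem inner_pt {ω : Plane} (hω : ω ∈ Metric.sphere (0 : Plane) 1) (p u : ℝ) :
    inner ℝ (pt ω p u) ω = p := by
  rw [inner_eq, pt_zero, pt_one]
  linear_combination p * sq_add_sq hω

theorem inner_pt_perp {ω : Plane} (hω : ω ∈ Metric.sphere (0 : Plane) 1) (p u : ℝ) :
    inner ℝ (pt ω p u) (perp ω) = u := by
  rw [inner_perp, pt_zero, pt_one]
  linear_combination u * sq_add_sq hω

theorem pt_inner {ω : Plane} (hω : ω ∈ Metric.sphere (0 : Plane) 1) (x : Plane) :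
    pt ω (inner ℝ x ω) (inner ℝ x (perp ω)) = x := by
  have h := sq_add_sq hω
  ext i
  fin_cases i
  · simp only [Fin.zero_eta, pt_zero, inner_eq]
    simp [perp]; linear_combination x 0 * h
  · simp only [Fin.mk_one, pt_one, inner_eq]
    simp [perp]; linear_combination x 1 * h

theorem continuous_pt : Continuous fun z : Plane × ℝ × ℝ => pt z.1 z.2.1 z.2.2 := by
  refine (PiLp.homeomorph 2 (fun _ : Fin 2 => ℝ)).isInducing.continuous_iff.2 ?_
  refine continuous_pi fun i => ?_
  fin_cases i
  · show Continuous fun z : Plane × ℝ × ℝ => pt z.1 z.2.1 z.2.2 0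
    simp only [pt_zero]; fun_prop
  · show Continuous fun z : Plane × ℝ × ℝ => pt z.1 z.2.1 z.2.2 1
    simp only [pt_one]; fun_prop

theorem measurePreserving_pt {ω : Plane} (hω : ω ∈ Metric.sphere (0 : Plane) 1) :
    MeasurePreserving (fun z : ℝ × ℝ => pt ω z.1 z.2) := by
  let T : Plane →ₗ[ℝ] Plane :=
    { toFun := fun x => pt ω (x 0) (x 1)
      map_add' := fun x y => by simp only [pt, PiLp.add_apply]; module
      map_smul' := fun c x => by simp only [pt, PiLp.smul_apply, smul_eq_mul, RingHom.id_apply]; module }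
  let I : Plane →ₗᵢ[ℝ] Plane :=
    { T with
      norm_map' := fun x => by
        have h : ‖T x‖ ^ 2 = ‖x‖ ^ 2 := by
          rw [EuclideanSpace.norm_sq_eq, EuclideanSpace.norm_sq_eq]
          simp only [Fin.sum_univ_two, Real.norm_eq_abs, sq_abs]
          show pt ω (x 0) (x 1) 0 ^ 2 + pt ω (x 0) (x 1) 1 ^ 2 = _
          rw [pt_zero, pt_one]
          linear_combination (x 0 ^ 2 + x 1 ^ 2) * sq_add_sq hω
        exact (pow_left_inj₀ (norm_nonneg _) (norm_nonneg _) two_ne_zero).1 h }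
  have h1 := (I.toLinearIsometryEquiv rfl).measurePreserving
  have h2 := (PiLp.volume_preserving_toLp (Fin 2)).comp (volume_preserving_finTwoArrow ℝ).symm
  exact h1.comp h2

theorem measurableEmbedding_pt {ω : Plane} (hω : ω ∈ Metric.sphere (0 : Plane) 1) :
    MeasurableEmbedding (fun z : ℝ × ℝ => pt ω z.1 z.2) := by
  refine Continuous.measurableEmbedding ?_ fun z z' h => ?_
  · exact continuous_pt.comp (by fun_prop : Continuous fun z : ℝ × ℝ => (ω, z))
  · have h1 := congrArg (fun x => inner ℝ x ω) h
    have h2 := congrArg (fun x => inner ℝ x (perp ω)) h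
    simp only [inner_pt hω, inner_pt_perp hω] at h1 h2
    exact Prod.ext h1 h2

/-- Integrals over a strip, evaluated along the lines with normal vector `ω`. -/
theorem integral_strip {ω : Plane} (hω : ω ∈ Metric.sphere (0 : Plane) 1) {f : Plane → ℝ}
    (hf : Continuous f) {g w : ℝ → ℝ} (hg : Measurable g) (hw : Continuous w) {a b B C : ℝ}
    (hab : a ≤ b) (hgB : ∀ p, |g p| ≤ B) (hg0 : ∀ p, p ∉ Icc a b → g p = 0)
    (hint : ∀ p ∈ Icc a b, Integrable fun u => w u * f (pt ω p u))
    (hC : ∀ p ∈ Icc a b, ∫ u, |w u * f (pt ω p u)| ≤ C) :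
    Integrable (fun x => g (inner ℝ x ω) * (w (inner ℝ x (perp ω)) * f x)) ∧
    ∫ x, g (inner ℝ x ω) * (w (inner ℝ x (perp ω)) * f x) =
      ∫ p, g p * ∫ u, w u * f (pt ω p u) ∧
    ∫ x, |g (inner ℝ x ω) * (w (inner ℝ x (perp ω)) * f x)| ≤ B * C * (b - a) := by
  have hB : 0 ≤ B := (abs_nonneg _).trans (hgB 0)
  have hm := measurePreserving_pt hω
  have he := measurableEmbedding_pt hω
  have hcont : Continuous fun z : ℝ × ℝ => f (pt ω z.1 z.2) :=
    hf.comp (continuous_pt.comp (by fun_prop : Continuous fun z : ℝ × ℝ => (ω, z)))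
  have hmeas : AEStronglyMeasurable (fun z : ℝ × ℝ => g z.1 * (w z.2 * f (pt ω z.1 z.2)))
      (volume.prod volume) := by
    refine Measurable.aestronglyMeasurable ?_
    have := hcont.measurable
    have := hw.measurable
    fun_prop
  -- This one bound gives both joint integrability and the final estimate.
  have hbd : ∀ p, ∫ u, ‖g p * (w u * f (pt ω p u))‖ ≤ (Icc a b).indicator (fun _ => B * C) p := by
    intro p
    by_cases hp : p ∈ Icc a b
    · simp only [norm_mul (g p), integral_const_mul, indicator_of_mem hp]
      exact mul_le_mul (hgB p) (hC p hp) (integral_nonneg fun _ => norm_nonneg _) hB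
    · simp [hg0 p hp, hp]
  have hind : Integrable ((Icc a b).indicator fun _ : ℝ => B * C) := by
    rw [integrable_indicator_iff measurableSet_Icc]
    exact integrableOn_const (by simp)
  have hF : Integrable (fun z : ℝ × ℝ => g z.1 * (w z.2 * f (pt ω z.1 z.2)))
      (volume.prod volume) := by
    rw [integrable_prod_iff hmeas]
    refine ⟨Eventually.of_forall fun p => ?_, ?_⟩
    · show Integrable fun u => g p * (w u * f (pt ω p u))
      by_cases hp : p ∈ Icc a b
      · exact (hint p hp).const_mul _
      · simp [hg0 p hp]
    · refine hind.mono' hmeas.norm.integral_prod_right' (Eventually.of_forall fun p => ?_)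
      rw [Real.norm_of_nonneg (integral_nonneg fun _ => norm_nonneg _)]
      exact hbd p
  have e1 : ((fun x => g (inner ℝ x ω) * (w (inner ℝ x (perp ω)) * f x)) ∘
      fun z : ℝ × ℝ => pt ω z.1 z.2) = fun z => g z.1 * (w z.2 * f (pt ω z.1 z.2)) := by
    ext z; simp only [Function.comp, inner_pt hω, inner_pt_perp hω]
  refine ⟨?_, ?_, ?_⟩
  · rw [← hm.integrable_comp_emb he, e1]; exact hF
  · rw [← hm.integral_comp he]
    simp only [inner_pt hω, inner_pt_perp hω]
    rw [Measure.volume_eq_prod, integral_prod _ hF]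
    simp only [integral_const_mul]
  · rw [← hm.integral_comp he]
    simp only [inner_pt hω, inner_pt_perp hω]
    rw [Measure.volume_eq_prod, integral_prod _ hF.abs]
    refine (integral_mono hF.norm.integral_prod_left hind hbd).trans ?_
    rw [integral_indicator measurableSet_Icc]
    simp [hab, mul_comm]

theorem mem_avoiding {K : Set Plane} {ω : Plane} {p : ℝ} :
    p ∈ avoiding K ω ↔ ∀ x ∈ K, inner ℝ x ω ≠ p := by
  simp only [avoiding, line, mem_ofPred_eq, disjoint_right]

/-! ### Weights and bounds uniform over a strip -/

/-- The polynomial weight of order `k` times the exponential weight. -/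
def weight (lam : ℝ) (k : ℕ) (u : ℝ) : ℝ := (1 + |u|) ^ k * Real.exp (-(lam * u))

theorem weight_nonneg (lam : ℝ) (k : ℕ) (u : ℝ) : 0 ≤ weight lam k u := by
  unfold weight; positivity

theorem continuous_weight (lam : ℝ) (k : ℕ) : Continuous (weight lam k) := by
  unfold weight; fun_prop

theorem weight_succ (lam : ℝ) (k : ℕ) (u : ℝ) :
    weight lam (k + 1) u = (1 + |u|) * weight lam k u := by
  unfold weight; ring

theorem weight_mono (lam : ℝ) {k m : ℕ} (h : k ≤ m) (u : ℝ) :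
    weight lam k u ≤ weight lam m u := by
  unfold weight
  gcongr
  linarith [abs_nonneg u]

/-- A unit shift at most doubles `1 + |u|` and changes the exponent by at most `|lam|`. This lets a
weight at a rotated point be compared with one at the original point. -/
theorem weight_le_of_abs_sub_le_one (lam : ℝ) (k : ℕ) {u v : ℝ} (h : |v - u| ≤ 1) :
    weight lam k v ≤ 2 ^ k * Real.exp |lam| * weight lam k u := by
  have h1 : 1 + |v| ≤ 2 * (1 + |u|) := by
    have : |v| ≤ |u| + |v - u| := by simpa using abs_add_le u (v - u)
    linarith [abs_nonneg u]
  have h2 : -(lam * v) ≤ |lam| + -(lam * u) := by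
    have : lam * (u - v) ≤ |lam| * 1 := by
      refine (le_abs_self _).trans ?_
      rw [abs_mul, abs_sub_comm]; gcongr
    linarith
  calc weight lam k v ≤ (2 * (1 + |u|)) ^ k * Real.exp (|lam| + -(lam * u)) := by
        unfold weight; gcongr
    _ = _ := by unfold weight; rw [mul_pow, Real.exp_add]; ring

theorem abs_pow_mul_exp_le_weight (lam : ℝ) (k : ℕ) (u : ℝ) :
    |u ^ k * Real.exp (-(lam * u))| ≤ weight lam k u := by
  rw [abs_mul, abs_pow, Real.abs_exp]
  unfold weight
  gcongr
  linarith

/-- Compactness of `[a, b]` turns the bounds local in `p` into one bound and one `ε`. -/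
theorem exists_bound_of_rapidDecay {lam : ℝ} {K Ω : Set Plane} {f : Plane → ℝ} {ω₀ : Plane}
    (hdec : RapidDecay lam K Ω (fun _ x => f x) ω₀) {a b : ℝ} (hab : Icc a b ⊆ avoiding K ω₀)
    (k : ℕ) : ∃ ε > (0 : ℝ), ∃ C : ℝ, ∀ ω ∈ Ω, dist ω ω₀ < ε → ∀ p ∈ Icc a b, p ∈ avoiding K ω →
      Integrable (fun u : ℝ => u ^ k * (Real.exp (-(lam * u)) * f (pt ω p u))) ∧
      ∫ u : ℝ, |u ^ k * (Real.exp (-(lam * u)) * f (pt ω p u))| ≤ C := by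
  refine isCompact_Icc.induction_on (s := Icc a b)
    (p := fun s => ∃ ε > (0 : ℝ), ∃ C : ℝ, ∀ ω ∈ Ω, dist ω ω₀ < ε → ∀ p ∈ s, p ∈ avoiding K ω →
      Integrable (fun u : ℝ => u ^ k * (Real.exp (-(lam * u)) * f (pt ω p u))) ∧
      ∫ u : ℝ, |u ^ k * (Real.exp (-(lam * u)) * f (pt ω p u))| ≤ C) ?_ ?_ ?_ ?_
  · exact ⟨1, one_pos, 0, by simp⟩
  · rintro s t hst ⟨ε, hε, C, h⟩
    exact ⟨ε, hε, C, fun ω hω hd p hp => h ω hω hd p (hst hp)⟩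
  · rintro s t ⟨ε, hε, C, h⟩ ⟨ε', hε', C', h'⟩
    refine ⟨min ε ε', lt_min hε hε', max C C', fun ω hω hd p hp hpa => ?_⟩
    rcases hp with hp | hp
    · have := h ω hω (hd.trans_le (min_le_left _ _)) p hp hpa
      exact ⟨this.1, this.2.trans (le_max_left _ _)⟩
    · have := h' ω hω (hd.trans_le (min_le_right _ _)) p hp hpa
      exact ⟨this.1, this.2.trans (le_max_right _ _)⟩
  · intro p hp
    obtain ⟨ε, hε, C, h⟩ := hdec p (hab hp) k
    refine ⟨Metric.ball p ε, mem_nhdsWithin_of_mem_nhds (Metric.ball_mem_nhds p hε), ε, hε, C, ?_⟩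
    intro ω hω hd p' hp' hpa
    have := h ω hω hd p' hpa (by simpa [Real.dist_eq] using hp')
    exact ⟨this.1, this.2.le⟩

/-- The integrability condition for all lines with parameters in `[a, b]` and normal vectors
in `S`. -/
def WeightBound (lam : ℝ) (f : Plane → ℝ) (S : Set Plane) (a b : ℝ) (k : ℕ) (C : ℝ) : Prop :=
  ∀ ω ∈ S, ∀ p ∈ Icc a b, Integrable (fun u => weight lam k u * f (pt ω p u)) ∧
    ∫ u, |weight lam k u * f (pt ω p u)| ≤ C

/-- The decay conditions of orders `0` and `k` combine through `(1 + |u|)^k ≤ 2^k (1 + |u|^k)`. -/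
theorem exists_weightBound {lam : ℝ} {K Ω : Set Plane} {f : Plane → ℝ} (hf : Continuous f)
    {ω₀ : Plane} (hdec : RapidDecay lam K Ω (fun _ x => f x) ω₀) {a b : ℝ}
    (hab : Icc a b ⊆ avoiding K ω₀) (k : ℕ) : ∃ ε > (0 : ℝ), ∃ C : ℝ,
      WeightBound lam f {ω ∈ Ω | dist ω ω₀ < ε ∧ Icc a b ⊆ avoiding K ω} a b k C := by
  obtain ⟨ε, hε, C, h⟩ := exists_bound_of_rapidDecay hdec hab k
  obtain ⟨ε', hε', C', h'⟩ := exists_bound_of_rapidDecay hdec hab 0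
  refine ⟨min ε ε', lt_min hε hε', 2 ^ k * (C' + C), fun ω hω p hp => ?_⟩
  obtain ⟨h1, h2⟩ := h ω hω.1 (hω.2.1.trans_le (min_le_left _ _)) p hp (hω.2.2 hp)
  obtain ⟨h3, h4⟩ := h' ω hω.1 (hω.2.1.trans_le (min_le_right _ _)) p hp (hω.2.2 hp)
  simp only [pow_zero, one_mul] at h3 h4
  have hc : Continuous fun u => f (pt ω p u) :=
    hf.comp (continuous_pt.comp (by fun_prop : Continuous fun u : ℝ => (ω, p, u)))
  have hle : ∀ u, |weight lam k u * f (pt ω p u)| ≤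
      2 ^ k * (|Real.exp (-(lam * u)) * f (pt ω p u)| +
        |u ^ k * (Real.exp (-(lam * u)) * f (pt ω p u))|) := by
    intro u
    rw [abs_mul, abs_of_nonneg (weight_nonneg _ _ _), abs_mul (u ^ k), abs_mul (Real.exp _),
      Real.abs_exp, weight, abs_pow]
    have : (1 + |u|) ^ k ≤ 2 ^ k * (1 + |u| ^ k) := by
      refine (add_pow_le zero_le_one (abs_nonneg u) k).trans ?_
      rw [one_pow]
      gcongr
      · norm_num
      · exact Nat.sub_le k 1
    calc (1 + |u|) ^ k * Real.exp (-(lam * u)) * |f (pt ω p u)|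
        ≤ 2 ^ k * (1 + |u| ^ k) * Real.exp (-(lam * u)) * |f (pt ω p u)| := by gcongr
      _ = _ := by ring
  have hI := ((h3.abs.add h1.abs).const_mul (2 ^ k))
  have hc' := continuous_weight lam k
  have hint : Integrable (fun u => weight lam k u * f (pt ω p u)) :=
    hI.mono' (hc'.mul hc).aestronglyMeasurable (Eventually.of_forall hle)
  refine ⟨hint, (integral_mono hint.abs hI hle).trans ?_⟩
  simp only [Pi.add_apply]
  rw [integral_const_mul, integral_add h3.abs h1.abs]
  gcongr

theorem WeightBound.integrable_of_abs_le {lam : ℝ} {f : Plane → ℝ} (hf : Continuous f)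
    {S : Set Plane} {a b : ℝ} {k : ℕ} {C : ℝ} (h : WeightBound lam f S a b k C) {w : ℝ → ℝ}
    (hw : Continuous w) {A : ℝ} (hA : 0 ≤ A) (hwA : ∀ u, |w u| ≤ A * weight lam k u)
    {ω : Plane} (hω : ω ∈ S) {p : ℝ} (hp : p ∈ Icc a b) :
    Integrable (fun u => w u * f (pt ω p u)) ∧ ∫ u, |w u * f (pt ω p u)| ≤ A * C := by
  obtain ⟨h1, h2⟩ := h ω hω p hp
  have hc : Continuous fun u => f (pt ω p u) :=
    hf.comp (continuous_pt.comp (by fun_prop : Continuous fun u : ℝ => (ω, p, u)))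
  have hle : ∀ u, |w u * f (pt ω p u)| ≤ A * |weight lam k u * f (pt ω p u)| := by
    intro u
    rw [abs_mul, abs_mul, abs_of_nonneg (weight_nonneg _ _ _), ← mul_assoc]
    gcongr
    exact hwA u
  have hint : Integrable (fun u => w u * f (pt ω p u)) :=
    (h1.abs.const_mul A).mono' (hw.mul hc).aestronglyMeasurable (Eventually.of_forall hle)
  refine ⟨hint, (integral_mono hint.abs (h1.abs.const_mul A) hle).trans ?_⟩
  rw [integral_const_mul]
  gcongr

/-! ### Strips avoiding `K` in nearby directions -/

/-- If the strip `[a, b]` avoids `K` in direction `ω₀`, then it avoids `K` in directions of `Ω`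
that accumulate at `ω₀`. -/
theorem accPt_strip {K Ω : Set Plane} (hK : Convex ℝ K) (hΩ : Preperfect Ω)
    (hΩK : ∀ p : ℝ, Preperfect {ω ∈ Ω | p ∈ avoiding K ω}) {ω₀ : Plane} (h₀ : ω₀ ∈ Ω)
    {a b : ℝ} (hle : a ≤ b) (hab : Icc a b ⊆ avoiding K ω₀) :
    AccPt ω₀ (𝓟 {ω ∈ Ω | Icc a b ⊆ avoiding K ω}) := by
  rcases K.eq_empty_or_nonempty with rfl | ⟨x₀, hx₀⟩
  · refine (hΩ ω₀ h₀).mono (principal_mono.2 fun ω hω => ⟨hω, fun p _ => ?_⟩)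
    simp [mem_avoiding]
  have himage (ω : Plane) : OrdConnected ((fun x : Plane => inner ℝ x ω) '' K) :=
    (hK.isPreconnected.image _ (by fun_prop)).ordConnected
  have hcont : Continuous fun ω : Plane => inner ℝ x₀ ω := by fun_prop
  have hx : inner ℝ x₀ ω₀ < a ∨ b < inner ℝ x₀ ω₀ := by
    by_contra! h
    exact mem_avoiding.1 (hab h) x₀ hx₀ rfl
  -- It is enough to avoid the edge line facing `K`: `⟨x₀, ω⟩` stays beyond that edge for nearby
  -- `ω`, and the projection of `K` is an interval, so it cannot reach the strip without crossing
  -- the edge.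
  have aux (e : ℝ) (he : e ∈ Icc a b) (U : Set Plane) (hU : U ∈ 𝓝 ω₀)
      (hUe : ∀ ω ∈ U, e ∈ avoiding K ω → Icc a b ⊆ avoiding K ω) :
      AccPt ω₀ (𝓟 {ω ∈ Ω | Icc a b ⊆ avoiding K ω}) := by
    refine ((hΩK e ω₀ ⟨h₀, hab he⟩).nhds_inter hU).mono (principal_mono.2 ?_)
    rintro ω ⟨hω, hω', he'⟩
    exact ⟨hω', hUe ω hω he'⟩
  rcases hx with hx | hx
  · refine aux a (left_mem_Icc.2 hle) _ (hcont.continuousAt.eventually_lt_const hx) ?_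
    intro ω hω ha p hp
    rw [mem_avoiding] at ha ⊢
    rintro x hx rfl
    obtain ⟨y, hy, hya⟩ := (himage ω).out (mem_image_of_mem _ hx₀) (mem_image_of_mem _ hx)
      (⟨(show inner ℝ x₀ ω < a from hω).le, hp.1⟩ : a ∈ Icc _ _)
    exact ha y hy hya
  · refine aux b (right_mem_Icc.2 hle) _ (hcont.continuousAt.eventually_const_lt hx) ?_
    intro ω hω ha p hp
    rw [mem_avoiding] at ha ⊢
    rintro x hx rfl
    obtain ⟨y, hy, hya⟩ := (himage ω).out (mem_image_of_mem _ hx) (mem_image_of_mem _ hx₀)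
      (⟨hp.2, (show b < inner ℝ x₀ ω from hω).le⟩ : b ∈ Icc _ _)
    exact ha y hy hya

/-! ### Estimates for small rotations -/

/-- Bound for the variation of `φ(p) w(u)` under a small rotation with sine `s`, as long as
the rotation moves `p` by a small amount. -/
theorem abs_rotation_sub_le {lam : ℝ} {k : ℕ} {A B L P δ : ℝ} {φ w w' : ℝ → ℝ} (hA : 0 ≤ A)
    (hL : 0 ≤ L) (hP : 0 ≤ P) (hδ : 0 ≤ δ)
    (hφB : ∀ p, |φ p| ≤ B) (hφL : ∀ p q, |φ p - φ q| ≤ L * |p - q|)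
    (hw : ∀ u, HasDerivAt w (w' u) u) (hwA : ∀ u, |w u| ≤ A * weight lam k u)
    (hwA' : ∀ u, |w' u| ≤ A * weight lam k u) {c s p u : ℝ} (hc : |c - 1| ≤ s ^ 2)
    (hs : |s| ≤ 1) (hs' : |s| * (δ + P) ≤ 1) (hp : |p| ≤ P) (hsu : |s * u| ≤ δ) :
    |φ (c * p + s * u) * w (c * u - s * p) - φ p * w u| ≤
      |s| * ((L * (P + 1) + B * (δ + P)) * (A * (2 ^ k * Real.exp |lam|)) *
        weight lam (k + 1) u) := by
  have hB : 0 ≤ B := (abs_nonneg _).trans (hφB 0)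
  have hss : s ^ 2 = |s| * |s| := by rw [← sq_abs, sq]
  have hW := weight_nonneg lam k u
  set v := c * u - s * p with hv
  set D := A * (2 ^ k * Real.exp |lam| * weight lam k u) with hD
  have hD0 : 0 ≤ D := by positivity
  have h1 : |c * p + s * u - p| ≤ |s| * (P + |u|) := by
    calc |c * p + s * u - p| = |(c - 1) * p + s * u| := by ring_nf
      _ ≤ |(c - 1) * p| + |s * u| := abs_add_le _ _
      _ = |c - 1| * |p| + |s| * |u| := by rw [abs_mul, abs_mul]
      _ ≤ (|s| * |s|) * P + |s| * |u| := by gcongr; exact hc.trans hss.le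
      _ ≤ (|s| * 1) * P + |s| * |u| := by gcongr
      _ = _ := by ring
  -- The cosine error is harmless even for large `u`: `|c - 1| |u| ≤ s² |u| = |s| |s u| ≤ |s| δ`.
  -- Only the shift of `p` costs a factor `1 + |u|`, hence the order `k + 1`.
  have h2 : |v - u| ≤ |s| * (δ + P) := by
    calc |v - u| = |(c - 1) * u - s * p| := by rw [hv]; ring_nf
      _ ≤ |(c - 1) * u| + |s * p| := abs_sub _ _
      _ = |c - 1| * |u| + |s| * |p| := by rw [abs_mul, abs_mul]
      _ ≤ (|s| * |s|) * |u| + |s| * P := by gcongr; exact hc.trans hss.le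
      _ = |s| * |s * u| + |s| * P := by rw [abs_mul]; ring
      _ ≤ |s| * δ + |s| * P := by gcongr
      _ = _ := by ring
  have h3 : |w v| ≤ D := by
    refine (hwA v).trans ?_
    rw [hD]; gcongr; exact weight_le_of_abs_sub_le_one lam k (h2.trans hs')
  have h4 : |w v - w u| ≤ D * |v - u| := by
    have := (convex_uIcc u v).norm_image_sub_le_of_norm_hasDerivWithin_le (f := w) (f' := w')
      (C := D) (fun x _ => (hw x).hasDerivWithinAt) (fun x hx => ?_) left_mem_uIcc right_mem_uIcc
    · simpa using this
    · refine (hwA' x).trans ?_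
      rw [hD]; gcongr
      refine weight_le_of_abs_sub_le_one lam k (le_trans ?_ (h2.trans hs'))
      exact abs_sub_left_of_mem_uIcc hx
  have h5 : |φ (c * p + s * u) - φ p| ≤ L * (|s| * (P + |u|)) :=
    (hφL _ _).trans (by gcongr)
  calc |φ (c * p + s * u) * w v - φ p * w u|
      = |(φ (c * p + s * u) - φ p) * w v + φ p * (w v - w u)| := by ring_nf
    _ ≤ |φ (c * p + s * u) - φ p| * |w v| + |φ p| * |w v - w u| := by
        rw [← abs_mul, ← abs_mul]; exact abs_add_le _ _
    _ ≤ (L * (|s| * (P + |u|))) * D + B * (D * (|s| * (δ + P))) := by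
        gcongr
        · exact hφB p
        · exact h4.trans (by gcongr)
    _ ≤ (L * (|s| * ((P + 1) * (1 + |u|)))) * D +
          B * (D * (|s| * ((δ + P) * (1 + |u|)))) := by
        have := abs_nonneg u
        gcongr
        · nlinarith
        · exact le_mul_of_one_le_right (by positivity) (by linarith)
    _ = _ := by rw [weight_succ, hD]; ring

/-- Derivative of `φ(p) w(u)` under rotations. -/
theorem tendsto_rotation_quotient {φ w : ℝ → ℝ} {φ' w' p u : ℝ} (hφ : HasDerivAt φ φ' p)
    (hw : HasDerivAt w w' u) :
    Tendsto (fun s : ℝ => (φ (√(1 - s ^ 2) * p + s * u) * w (√(1 - s ^ 2) * u - s * p) -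
      φ p * w u) / s) (𝓝[≠] 0) (𝓝 (φ' * u * w u - p * φ p * w')) := by
  have hc : HasDerivAt (fun s : ℝ => √(1 - s ^ 2)) 0 0 := by
    have := ((hasDerivAt_pow 2 (0 : ℝ)).const_sub 1).sqrt (by norm_num)
    simpa using this
  have h1 : HasDerivAt (fun s : ℝ => √(1 - s ^ 2) * p + s * u) u 0 := by
    have := (hc.mul_const p).fun_add ((hasDerivAt_id (0 : ℝ)).mul_const u)
    simpa using this
  have h2 : HasDerivAt (fun s : ℝ => √(1 - s ^ 2) * u - s * p) (-p) 0 := by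
    have := (hc.mul_const u).fun_sub ((hasDerivAt_id (0 : ℝ)).mul_const p)
    simpa using this
  have h3 := (HasDerivAt.comp_of_eq (0 : ℝ) hφ h1 (by simp)).mul
    (HasDerivAt.comp_of_eq (0 : ℝ) hw h2 (by simp))
  have h4 := hasDerivAt_iff_tendsto_slope.1 h3
  refine (h4.congr fun s => ?_).trans (le_of_eq ?_)
  · simp [slope_def_field]
  · congr 1; simp; ring

/-- The lines `p` moved by a small rotation into `[a', b']` come from `[a, b]`. -/
theorem mem_Icc_of_rotation {a b a' b' P δ c s p u : ℝ} (ha : a + 2 * δ ≤ a') (hb : b' + 2 * δ ≤ b)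
    (hP : ∀ q ∈ Icc a b, |q| ≤ P) (hδ : 0 ≤ δ) (hc : |c - 1| ≤ s ^ 2) (hc' : 1 / 2 ≤ c)
    (hs : s ^ 2 * (2 * (P + δ)) ≤ δ) (hsu : |s * u| ≤ δ) (hq : c * p + s * u ∈ Icc a' b') :
    p ∈ Icc a b := by
  have h0 : |c * p + s * u| ≤ P := hP _ ⟨by linarith [hq.1], by linarith [hq.2]⟩
  -- A crude bound from `c ≥ 1/2`. Then one `δ` of the margin absorbs `s u` and the other absorbs
  -- `(c - 1) p`.
  have h1 : |p| ≤ 2 * (P + δ) := by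
    have : |c * p| ≤ P + δ := by
      have := abs_sub (c * p + s * u) (s * u)
      rw [add_sub_cancel_right] at this
      linarith
    rw [abs_mul, abs_of_pos (by linarith)] at this
    nlinarith [abs_nonneg p]
  have h2 : |(c - 1) * p| ≤ δ := by
    rw [abs_mul]
    exact (mul_le_mul hc h1 (abs_nonneg _) (sq_nonneg _)).trans hs
  rw [abs_le] at h2 hsu
  constructor <;> nlinarith [hq.1, hq.2]

theorem inner_rotation {ω₀ : Plane} (h₀ : ω₀ ∈ Metric.sphere (0 : Plane) 1) (ω x : Plane) :
    inner ℝ x ω = inner ℝ ω ω₀ * inner ℝ x ω₀ + inner ℝ ω (perp ω₀) * inner ℝ x (perp ω₀) := by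
  simp only [inner_perp]
  simp only [inner_eq]
  linear_combination -(x 0 * ω 0 + x 1 * ω 1) * sq_add_sq h₀

theorem inner_perp_rotation {ω₀ : Plane} (h₀ : ω₀ ∈ Metric.sphere (0 : Plane) 1) (ω x : Plane) :
    inner ℝ x (perp ω) =
      inner ℝ ω ω₀ * inner ℝ x (perp ω₀) - inner ℝ ω (perp ω₀) * inner ℝ x ω₀ := by
  simp only [inner_perp]
  simp only [inner_eq]
  linear_combination -(x 1 * ω 0 - x 0 * ω 1) * sq_add_sq h₀

theorem cos_sq_add_sin_sq {ω₀ ω : Plane} (h₀ : ω₀ ∈ Metric.sphere (0 : Plane) 1)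
    (hω : ω ∈ Metric.sphere (0 : Plane) 1) :
    inner ℝ ω ω₀ ^ 2 + inner ℝ ω (perp ω₀) ^ 2 = 1 := by
  simp only [inner_perp]
  simp only [inner_eq]
  linear_combination (ω 0 ^ 2 + ω 1 ^ 2) * sq_add_sq h₀ + sq_add_sq hω

theorem inner_self_eq_one {ω₀ : Plane} (h₀ : ω₀ ∈ Metric.sphere (0 : Plane) 1) :
    inner ℝ ω₀ ω₀ = (1 : ℝ) := by
  rw [inner_eq]; linear_combination sq_add_sq h₀

theorem inner_self_perp (ω₀ : Plane) : inner ℝ ω₀ (perp ω₀) = (0 : ℝ) := by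
  rw [inner_perp]; ring

/-- Far out in a strip, a weight of order `k` is small compared to the one of order `k + 2`. -/
theorem abs_tail_le {lam : ℝ} {k : ℕ} {A P δ s u v q y : ℝ} {w : ℝ → ℝ}
    (hP : 0 ≤ P) (hδ : 0 < δ) (hwA : |w v| ≤ A * weight lam k v)
    (hsu : δ < |s * u|) (hu : q ≠ 0 → |u| ≤ P + |v|) :
    |q * (w v * y)| ≤ s ^ 2 * ((P + 1) ^ 2 / δ ^ 2 * A) * |q * (weight lam (k + 2) v * y)| := by
  by_cases hq : q = 0
  · simp [hq]
  have hu' : |u| ≤ (P + 1) * (1 + |v|) := by nlinarith [hu hq, abs_nonneg v]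
  -- Two extra powers of the weight buy a factor `s²`, so that a factor `s` is left after dividing
  -- by `s`.
  have h1 : 1 ≤ s ^ 2 * ((P + 1) ^ 2 / δ ^ 2) * (1 + |v|) ^ 2 := by
    have : δ ^ 2 ≤ s ^ 2 * ((P + 1) * (1 + |v|)) ^ 2 := by
      calc δ ^ 2 ≤ |s * u| ^ 2 := by gcongr
        _ = s ^ 2 * |u| ^ 2 := by rw [abs_mul, mul_pow, sq_abs]
        _ ≤ _ := by gcongr
    calc (1 : ℝ) = δ ^ 2 / δ ^ 2 := by field_simp
      _ ≤ (s ^ 2 * ((P + 1) * (1 + |v|)) ^ 2) / δ ^ 2 := by gcongr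
      _ = _ := by ring
  have hW := weight_nonneg lam k v
  have h2 : weight lam (k + 2) v = (1 + |v|) ^ 2 * weight lam k v := by
    rw [weight_succ, weight_succ]; ring
  have hAW : 0 ≤ A * weight lam k v := (abs_nonneg _).trans hwA
  calc |q * (w v * y)| = |w v| * |q * y| := by rw [← abs_mul]; ring_nf
    _ ≤ (A * weight lam k v) * |q * y| := by gcongr
    _ ≤ (s ^ 2 * ((P + 1) ^ 2 / δ ^ 2) * (1 + |v|) ^ 2) * ((A * weight lam k v) * |q * y|) :=
        le_mul_of_one_le_left (by positivity) h1
    _ = _ := by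
        rw [h2, abs_mul q, abs_mul q,
          abs_mul _ y, abs_mul _ (weight lam k v), abs_of_nonneg hW,
          abs_of_nonneg (by positivity : (0 : ℝ) ≤ (1 + |v|) ^ 2)]
        ring

theorem abs_cos_sub_one_le {c s : ℝ} (hc : 0 ≤ c) (h : c ^ 2 + s ^ 2 = 1) : |c - 1| ≤ s ^ 2 := by
  have : c ≤ 1 := by nlinarith [sq_nonneg s]
  rw [abs_sub_comm, abs_of_nonneg (by linarith)]
  nlinarith

/-! ### Differentiation with respect to the direction -/

/-- The difference quotients of `∫ φ(⟨x, ω⟩) w(⟨x, ω^⊥⟩) f(x) dx` are zero along `S`. Near the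
strip's core, where `|s u| ≤ δ`, they converge under domination by the weight of order `k + 1`; the
rest is `O(s)` by the weight of order `k + 2`. -/
theorem integral_deriv_mul_moment_eq_zero {lam : ℝ} {f : Plane → ℝ} (hf : Continuous f)
    {S : Set Plane} (hS : S ⊆ Metric.sphere (0 : Plane) 1) {ω₀ : Plane} (h₀ : ω₀ ∈ S)
    (hacc : AccPt ω₀ (𝓟 S)) {a b a' b' : ℝ} (ha : a < a') (hb : b' < b) (hab : a ≤ b)
    {k : ℕ} {C : ℝ} (hC : WeightBound lam f S a b (k + 2) C)
    {φ : ℝ → ℝ} (hφ : ContDiff ℝ 1 φ) (hφ0 : ∀ p, p ∉ Icc a' b' → φ p = 0)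
    {w w' : ℝ → ℝ} {A : ℝ} (hA : 0 ≤ A) (hw : ∀ u, HasDerivAt w (w' u) u)
    (hw'c : Continuous w')
    (hwA : ∀ u, |w u| ≤ A * weight lam k u) (hwA' : ∀ u, |w' u| ≤ A * weight lam k u)
    (hm : ∀ ω ∈ S, ∀ p ∈ Icc a b, ∫ u, w u * f (pt ω p u) = 0)
    (hm' : ∀ p ∈ Icc a b, ∫ u, w' u * f (pt ω₀ p u) = 0) :
    ∫ p, deriv φ p * ∫ u, (u * w u) * f (pt ω₀ p u) = 0 := by
  have hS₀ := hS h₀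
  have hwc : Continuous w := continuous_iff_continuousAt.2 fun u => (hw u).continuousAt
  have hcs : HasCompactSupport φ := HasCompactSupport.intro isCompact_Icc hφ0
  have hsub : Icc a' b' ⊆ Icc a b := Icc_subset_Icc ha.le hb.le
  have hφd0 : ∀ p, p ∉ Icc a' b' → deriv φ p = 0 := by
    intro p hp
    have : φ =ᶠ[𝓝 p] fun _ => 0 := by
      filter_upwards [isClosed_Icc.isOpen_compl.mem_nhds hp] with q hq using hφ0 q hq
    rw [this.deriv_eq, deriv_const]
  have hφdc : Continuous (deriv φ) := hφ.continuous_deriv le_rfl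
  obtain ⟨B, hB⟩ := hcs.exists_bound_of_continuous hφ.continuous
  obtain ⟨B', hB'⟩ := hcs.deriv.exists_bound_of_continuous hφdc
  obtain ⟨L, hL⟩ := hφ.lipschitzWith_of_hasCompactSupport hcs one_ne_zero
  have hφL : ∀ p q, |φ p - φ q| ≤ L * |p - q| := fun p q => by
    simpa [Real.dist_eq] using hL.dist_le_mul p q
  have hB0 : 0 ≤ B := (norm_nonneg _).trans (hB 0)
  set P := |a| + |b| with hPdef
  have hP0 : 0 ≤ P := by positivity
  have hP : ∀ q ∈ Icc a b, |q| ≤ P := by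
    intro q hq
    rw [abs_le]
    constructor
    · linarith [hq.1, neg_abs_le a, abs_nonneg b]
    · linarith [hq.2, le_abs_self b, abs_nonneg a]
  obtain ⟨δ, hδ, haδ, hbδ⟩ : ∃ δ > 0, a + 2 * δ ≤ a' ∧ b' + 2 * δ ≤ b := by
    refine ⟨min (a' - a) (b - b') / 2, by simp [ha, hb], ?_, ?_⟩
    · linarith [min_le_left (a' - a) (b - b')]
    · linarith [min_le_right (a' - a) (b - b')]
  have hstrip (g v : ℝ → ℝ) (hg : Measurable g) (hv : Continuous v) (m : ℕ) (hmk : m ≤ k + 2)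
      (A' D : ℝ) (hA' : 0 ≤ A') (hvA : ∀ u, |v u| ≤ A' * weight lam m u) (hgD : ∀ p, |g p| ≤ D)
      (hg0 : ∀ p, p ∉ Icc a b → g p = 0) (ω : Plane) (hω : ω ∈ S) :=
    integral_strip (hS hω) hf hg hv hab hgD hg0
      (fun p hp => (hC.integrable_of_abs_le hf hv hA' (fun u => (hvA u).trans
        (mul_le_mul_of_nonneg_left (weight_mono lam hmk u) hA')) hω hp).1)
      (fun p hp => (hC.integrable_of_abs_le hf hv hA' (fun u => (hvA u).trans
        (mul_le_mul_of_nonneg_left (weight_mono lam hmk u) hA')) hω hp).2)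
  set F : Plane → Plane → ℝ := fun ω x => φ (inner ℝ x ω) * (w (inner ℝ x (perp ω)) * f x) with hF
  have hFi (ω : Plane) (hω : ω ∈ S) : Integrable (F ω) ∧ ∫ x, F ω x = 0 := by
    have := hstrip φ w hφ.continuous.measurable hwc k (by omega) A B hA hwA hB
      (fun p hp => hφ0 p (fun h => hp (hsub h))) ω hω
    refine ⟨this.1, this.2.1.trans ?_⟩
    refine integral_eq_zero_of_ae (Eventually.of_forall fun p => ?_)
    by_cases hp : p ∈ Icc a b
    · simp [hm ω hω p hp]
    · simp [hφ0 p (fun h => hp (hsub h))]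
  set G : Plane → Plane → ℝ :=
    fun ω x => φ (inner ℝ x ω) * (weight lam (k + 2) (inner ℝ x (perp ω)) * f x) with hG
  have hGi (ω : Plane) (hω : ω ∈ S) : Integrable (G ω) ∧
      ∫ x, |G ω x| ≤ B * (1 * C) * (b - a) := by
    have := hstrip φ (weight lam (k + 2)) hφ.continuous.measurable (continuous_weight _ _) (k + 2)
      le_rfl 1 B zero_le_one (fun u => by rw [one_mul, abs_of_nonneg (weight_nonneg _ _ _)]) hB
      (fun p hp => hφ0 p (fun h => hp (hsub h))) ω hω
    exact ⟨this.1, this.2.2⟩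
  set c : Plane → ℝ := fun ω => inner ℝ ω ω₀ with hc
  set s : Plane → ℝ := fun ω => inner ℝ ω (perp ω₀) with hs
  set l : Filter Plane := 𝓝[≠] ω₀ ⊓ 𝓟 S with hl
  have : l.NeBot := hacc
  have hlS : ∀ᶠ ω in l, ω ∈ S := mem_inf_of_right (mem_principal_self S)
  have hlc : Tendsto c l (𝓝 1) := by
    have : Continuous c := by fun_prop
    have h := this.tendsto ω₀
    rw [show c ω₀ = 1 from inner_self_eq_one hS₀] at h
    exact h.mono_left (inf_le_left.trans nhdsWithin_le_nhds)
  have hls : Tendsto s l (𝓝 0) := by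
    have : Continuous s := by fun_prop
    have h := this.tendsto ω₀
    rw [show s ω₀ = 0 from inner_self_perp ω₀] at h
    exact h.mono_left (inf_le_left.trans nhdsWithin_le_nhds)
  have hc2 : ∀ᶠ ω in l, 1 / 2 < c ω := hlc.eventually_const_lt (by norm_num)
  have hcs1 : ∀ ω ∈ S, c ω ^ 2 + s ω ^ 2 = 1 := fun ω hω => cos_sq_add_sin_sq hS₀ (hS hω)
  -- A zero sine leaves only `±ω₀`, and `c ω > 1/2` excludes the antipode.
  have hsne : ∀ᶠ ω in l, s ω ≠ 0 := by
    have hne : ∀ᶠ ω in l, ω ≠ ω₀ := mem_inf_of_left self_mem_nhdsWithin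
    filter_upwards [hlS, hc2, hne] with ω hω h2 h3 h4
    have h5 : c ω = 1 := by have := hcs1 ω hω; rw [h4] at this; nlinarith
    apply h3
    rw [← pt_inner hS₀ ω]
    change pt ω₀ (c ω) (s ω) = ω₀
    rw [h4, h5]; simp [pt]
  have hls' : Tendsto s l (𝓝[≠] 0) := tendsto_nhdsWithin_iff.2 ⟨hls, hsne⟩
  have hla : Tendsto (fun ω => |s ω|) l (𝓝 0) := by simpa using hls.abs
  have hs1 : ∀ᶠ ω in l, |s ω| ≤ 1 := hla.eventually_le_const one_pos
  have hs2 : ∀ᶠ ω in l, |s ω| * (δ + P) ≤ 1 := by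
    have := hla.mul_const (δ + P)
    rw [zero_mul] at this
    exact this.eventually_le_const one_pos
  have hs3 : ∀ᶠ ω in l, s ω ^ 2 * (2 * (P + δ)) ≤ δ := by
    have := (hls.pow 2).mul_const (2 * (P + δ))
    simp only [ne_eq, OfNat.ofNat_ne_zero, not_false_eq_true, zero_pow, zero_mul] at this
    exact this.eventually_le_const hδ
  have hrot (ω x : Plane) : F ω x = φ (c ω * inner ℝ x ω₀ + s ω * inner ℝ x (perp ω₀)) *
      (w (c ω * inner ℝ x (perp ω₀) - s ω * inner ℝ x ω₀) * f x) := by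
    simp only [hF]
    rw [inner_rotation hS₀ ω x, inner_perp_rotation hS₀ ω x]
  -- On `E ω` the rotation moves `⟨x, ω₀⟩` little enough that the support of the rotated `φ` stays
  -- in the original strip; `E ω` exhausts the plane as `ω → ω₀`.
  set E : Plane → Set Plane := fun ω => {x | |s ω * inner ℝ x (perp ω₀)| ≤ δ} with hE
  have hEm (ω : Plane) : MeasurableSet (E ω) :=
    (isClosed_le (by fun_prop) continuous_const).measurableSet
  set Q : Plane → Plane → ℝ := fun ω x => (F ω x - F ω₀ x) / s ω with hQ
  have hQi (ω : Plane) (hω : ω ∈ S) : Integrable (Q ω) ∧ ∫ x, Q ω x = 0 := by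
    refine ⟨((hFi ω hω).1.sub (hFi ω₀ h₀).1).div_const _, ?_⟩
    simp only [hQ]
    rw [integral_div, integral_sub (hFi ω hω).1 (hFi ω₀ h₀).1, (hFi ω hω).2, (hFi ω₀ h₀).2]
    simp
  set lim : Plane → ℝ := fun x =>
    (deriv φ (inner ℝ x ω₀) * ((inner ℝ x (perp ω₀) * w (inner ℝ x (perp ω₀))) * f x)) -
    (inner ℝ x ω₀ * φ (inner ℝ x ω₀)) * (w' (inner ℝ x (perp ω₀)) * f x) with hlim
  have hT1 : Tendsto (fun ω => ∫ x, (E ω).indicator (Q ω) x) l (𝓝 (∫ x, lim x)) := by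
    set M := (L * (P + 1) + B * (δ + P)) * (A * (2 ^ k * Real.exp |lam|)) with hM
    have hind := hstrip ((Icc a b).indicator fun _ => 1) (weight lam (k + 1))
      (measurable_const.indicator measurableSet_Icc) (continuous_weight _ _) (k + 1)
      (by omega) 1 1 zero_le_one
      (fun u => by rw [one_mul, abs_of_nonneg (weight_nonneg _ _ _)])
      (fun p => by by_cases hp : p ∈ Icc a b <;> simp [hp]) (fun p hp => by simp [hp]) ω₀ h₀
    refine tendsto_integral_filter_of_dominated_convergence _ ?_ ?_ (hind.1.abs.const_mul M) ?_
    · filter_upwards [hlS] with ω hω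
      exact ((hQi ω hω).1.indicator (hEm ω)).aestronglyMeasurable
    · filter_upwards [hlS, hc2, hsne, hs1, hs2, hs3] with ω hω h2 hne h1 h3 h4
      refine Eventually.of_forall fun x => ?_
      have hc1 := abs_cos_sub_one_le (by linarith) (hcs1 ω hω)
      by_cases hx : x ∈ E ω
      · rw [indicator_of_mem hx, hQ]
        by_cases hp : inner ℝ x ω₀ ∈ Icc a b
        · have key := abs_rotation_sub_le hA L.coe_nonneg hP0 hδ.le hB hφL hw hwA hwA' hc1 h1 h3
            (hP _ hp) hx
          simp only [indicator_of_mem hp, one_mul, Real.norm_eq_abs, abs_div, abs_mul (weight _ _ _),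
            abs_of_nonneg (weight_nonneg _ _ _)]
          rw [div_le_iff₀ (abs_pos.2 hne), hrot ω x]
          calc _ = |φ (c ω * inner ℝ x ω₀ + s ω * inner ℝ x (perp ω₀)) *
                w (c ω * inner ℝ x (perp ω₀) - s ω * inner ℝ x ω₀) -
                φ (inner ℝ x ω₀) * w (inner ℝ x (perp ω₀))| * |f x| := by
                rw [← abs_mul]; congr 1; simp only [hF]; ring
            _ ≤ _ := mul_le_mul_of_nonneg_right key (abs_nonneg _)
            _ = _ := by rw [hM]; ring
        · have e1 : F ω₀ x = 0 := by simp only [hF]; rw [hφ0 _ fun h => hp (hsub h), zero_mul]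
          have e2 : F ω x = 0 := by
            rw [hrot, hφ0 _ fun h => hp
              (mem_Icc_of_rotation haδ hbδ hP hδ.le hc1 h2.le h4 hx h), zero_mul]
          simp [e1, e2, hp]
      · rw [indicator_of_notMem hx, norm_zero]
        refine mul_nonneg ?_ (abs_nonneg _)
        have := L.coe_nonneg
        positivity
    · refine Eventually.of_forall fun x => ?_
      have hq := (tendsto_rotation_quotient
        ((hφ.differentiable one_ne_zero).differentiableAt (x := inner ℝ x ω₀)).hasDerivAt
        (hw (inner ℝ x (perp ω₀)))).comp hls'
      have hev : ∀ᶠ ω in l, x ∈ E ω := by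
        have := (hls.mul_const (inner ℝ x (perp ω₀))).abs
        rw [zero_mul, abs_zero] at this
        exact this.eventually_le_const hδ
      have hq' := hq.mul_const (f x)
      refine (hq'.congr' ?_).trans (le_of_eq ?_)
      · filter_upwards [hev, hlS, hc2] with ω hx hω h2
        rw [indicator_of_mem hx]
        have hcsq : √(1 - s ω ^ 2) = c ω := by
          rw [← hcs1 ω hω, add_sub_cancel_right, Real.sqrt_sq (by linarith)]
        simp only [Function.comp, hQ, hcsq]
        rw [hrot ω x]
        simp only [hF]
        ring
      · congr 1; simp only [hlim]; ring
  have hT2 : Tendsto (fun ω => ∫ x, (E ω).indicator (Q ω) x) l (𝓝 0) := by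
    set T := (P + 1) ^ 2 / δ ^ 2 * A with hT
    have hT0 : 0 ≤ T := by positivity
    refine squeeze_zero_norm' (a := fun ω => |s ω| * (T * (2 * (B * (1 * C) * (b - a))))) ?_ ?_
    · filter_upwards [hlS, hc2, hsne, hs1] with ω hω h2 hne h1
      -- The full integral of the quotient is zero, so the core is controlled by the tail.
      have hsplit : ∫ x, (E ω).indicator (Q ω) x = -∫ x, (E ω)ᶜ.indicator (Q ω) x := by
        rw [integral_indicator (hEm ω), integral_indicator (hEm ω).compl, eq_neg_iff_add_eq_zero,
          integral_add_compl (hEm ω) (hQi ω hω).1, (hQi ω hω).2]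
      have hc1 : |c ω| ≤ 1 := by
        rw [abs_le]; constructor <;> nlinarith [hcs1 ω hω, sq_nonneg (s ω)]
      have hbd : Integrable fun x => |s ω| * (T * (|G ω x| + |G ω₀ x|)) :=
        (((hGi ω hω).1.abs.add (hGi ω₀ h₀).1.abs).const_mul T).const_mul _
      rw [hsplit, norm_neg]
      refine (norm_integral_le_of_norm_le hbd (Eventually.of_forall fun x => ?_)).trans ?_
      · by_cases hx : x ∈ E ω
        · rw [indicator_of_notMem (by simpa using hx), norm_zero]
          positivity
        · rw [indicator_of_mem (by simpa using hx), Real.norm_eq_abs, hQ, abs_div,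
            div_le_iff₀ (abs_pos.2 hne)]
          have hx' : δ < |s ω * inner ℝ x (perp ω₀)| := not_le.1 hx
          have t1 : |F ω x| ≤ s ω ^ 2 * T * |G ω x| := by
            refine abs_tail_le hP0 hδ (hwA _) hx' fun hne => ?_
            have hq : inner ℝ x ω ∈ Icc a' b' := by
              by_contra h; exact hne (hφ0 _ h)
            have hu : inner ℝ x (perp ω₀) = s ω * inner ℝ x ω + c ω * inner ℝ x (perp ω) := by
              rw [inner_rotation hS₀ ω x, inner_perp_rotation hS₀ ω x]
              linear_combination -(inner ℝ x (perp ω₀)) * hcs1 ω hω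
            rw [hu]
            refine (abs_add_le _ _).trans ?_
            rw [abs_mul, abs_mul]
            exact add_le_add ((mul_le_of_le_one_left (abs_nonneg _) h1).trans (hP _ (hsub hq)))
              (mul_le_of_le_one_left (abs_nonneg _) hc1)
          have t2 : |F ω₀ x| ≤ s ω ^ 2 * T * |G ω₀ x| :=
            abs_tail_le hP0 hδ (hwA _) hx' fun _ => by linarith
          refine (abs_sub _ _).trans ((add_le_add t1 t2).trans (le_of_eq ?_))
          rw [← sq_abs (s ω)]; ring
      · rw [integral_const_mul, integral_const_mul,
          integral_add (hGi ω hω).1.abs (hGi ω₀ h₀).1.abs]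
        gcongr
        linarith [(hGi ω hω).2, (hGi ω₀ h₀).2]
    · simpa using hla.mul_const (T * (2 * (B * (1 * C) * (b - a))))
  have hzero : ∫ x, lim x = 0 := tendsto_nhds_unique hT1 hT2
  have hI1 := hstrip (deriv φ) (fun u => u * w u) hφdc.measurable (by fun_prop) (k + 1) (by omega)
    A B' hA (fun u => by
      rw [abs_mul, weight_succ]
      have := weight_nonneg lam k u
      calc |u| * |w u| ≤ (1 + |u|) * (A * weight lam k u) := by
            gcongr
            · linarith
            · exact hwA u
        _ = _ := by ring) hB' (fun p hp => hφd0 p (fun h => hp (hsub h))) ω₀ h₀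
  have hI2 := hstrip (fun p => p * φ p) w' (by have := hφ.continuous.measurable; fun_prop) hw'c k
    (by omega) A (P * B) hA hwA' (fun p => by
      by_cases hp : p ∈ Icc a b
      · rw [abs_mul]; exact mul_le_mul (hP p hp) (hB p) (abs_nonneg _) hP0
      · rw [hφ0 p (fun h => hp (hsub h)), mul_zero, abs_zero]; positivity)
    (fun p hp => by rw [hφ0 p (fun h => hp (hsub h)), mul_zero]) ω₀ h₀
  rw [← hI1.2.1, ← hzero]
  simp only [hlim]
  rw [integral_sub hI1.1 hI2.1, hI2.2.1, eq_comm, sub_eq_self]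
  refine integral_eq_zero_of_ae (Eventually.of_forall fun p => ?_)
  by_cases hp : p ∈ Icc a b
  · simp [hm' p hp]
  · simp [hφ0 p (fun h => hp (hsub h))]

/-! ### Continuity of moments and vanishing weak derivatives -/

/-- One spare power of decay makes the truncated integrals converge uniformly in `p`, at rate `1 /
(n + 1)`. -/
theorem continuousOn_integral_line {lam : ℝ} {f : Plane → ℝ} (hf : Continuous f)
    {S : Set Plane} {ω₀ : Plane} (h₀ : ω₀ ∈ S) {a b : ℝ} {m : ℕ} {C : ℝ}
    (hC : WeightBound lam f S a b (m + 1) C) {v : ℝ → ℝ} (hv : Continuous v) {A : ℝ} (hA : 0 ≤ A)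
    (hvA : ∀ u, |v u| ≤ A * weight lam m u) :
    ContinuousOn (fun p => ∫ u, v u * f (pt ω₀ p u)) (Icc a b) := by
  have hcont : Continuous fun z : ℝ × ℝ => f (pt ω₀ z.1 z.2) :=
    hf.comp (continuous_pt.comp (by fun_prop : Continuous fun z : ℝ × ℝ => (ω₀, z)))
  have hF (n : ℕ) : Continuous fun p => ∫ u in (-(n + 1 : ℝ))..(n + 1), v u * f (pt ω₀ p u) := by
    refine intervalIntegral.continuous_parametric_intervalIntegral_of_continuous' ?_ _ _
    exact (hv.comp continuous_snd).mul hcont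
  refine TendstoUniformlyOn.continuousOn (F := fun (n : ℕ) p =>
    ∫ u in (-(n + 1 : ℝ))..(n + 1), v u * f (pt ω₀ p u)) (p := atTop) ?_
    (Frequently.of_forall fun n => (hF n).continuousOn)
  have hvA1 : ∀ u, |v u| ≤ A * weight lam (m + 1) u := fun u =>
    (hvA u).trans (mul_le_mul_of_nonneg_left (weight_mono lam (Nat.le_succ m) u) hA)
  have hvA2 : ∀ u, |(1 + |u|) * v u| ≤ A * weight lam (m + 1) u := fun u => by
    have : 0 ≤ 1 + |u| := by positivity
    rw [abs_mul, abs_of_nonneg this, weight_succ, mul_left_comm]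
    exact mul_le_mul_of_nonneg_left (hvA u) this
  have hbound (n : ℕ) (p : ℝ) (hp : p ∈ Icc a b) :
      |(∫ u, v u * f (pt ω₀ p u)) - ∫ u in (-(n + 1 : ℝ))..(n + 1), v u * f (pt ω₀ p u)| ≤
        1 / (n + 1 : ℝ) * (A * C) := by
    have h1 := hC.integrable_of_abs_le hf hv hA hvA1 h₀ hp
    have h2 := hC.integrable_of_abs_le hf (w := fun u => (1 + |u|) * v u) (by fun_prop) hA hvA2 h₀ hp
    have hn : (0 : ℝ) < n + 1 := by positivity
    rw [intervalIntegral.integral_of_le (by linarith),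
      ← integral_add_compl measurableSet_Ioc h1.1, add_sub_cancel_left,
      ← integral_indicator measurableSet_Ioc.compl]
    rw [← Real.norm_eq_abs]
    refine (norm_integral_le_of_norm_le (h2.1.abs.const_mul (1 / (n + 1 : ℝ)))
      (Eventually.of_forall fun u => ?_)).trans ?_
    · by_cases hu : u ∈ Ioc (-(n + 1 : ℝ)) (n + 1)
      · rw [indicator_of_notMem (by simpa using hu), norm_zero]; positivity
      · rw [indicator_of_mem hu, Real.norm_eq_abs, mul_assoc (1 + |u|), abs_mul (1 + |u|),
          ← mul_assoc]
        refine le_mul_of_one_le_left (abs_nonneg _) ?_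
        have hu' : (n + 1 : ℝ) ≤ |u| := by
          by_contra! h
          exact hu ⟨(abs_lt.1 h).1, (abs_lt.1 h).2.le⟩
        rw [abs_of_nonneg (by positivity), one_div, ← div_eq_inv_mul, one_le_div hn]
        linarith
    · rw [integral_const_mul]
      gcongr
      exact h2.2
  rw [Metric.tendstoUniformlyOn_iff]
  intro ε hε
  have ht : Tendsto (fun n : ℕ => 1 / ((n : ℝ) + 1) * (A * C)) atTop (𝓝 0) := by
    simpa using tendsto_one_div_add_atTop_nhds_zero_nat.mul_const (A * C)
  filter_upwards [ht.eventually_lt_const hε] with n hn p hp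
  exact (hbound n p hp).trans_lt hn

/-- A continuous function whose weak derivative vanishes is constant. -/
theorem eq_of_integral_deriv_mul_eq_zero {N : ℝ → ℝ} (hN : Continuous N) {a b : ℝ} (hab : a < b)
    (h : ∀ (a' b' : ℝ), a < a' → b' < b → ∀ φ : ℝ → ℝ, ContDiff ℝ 1 φ →
      (∀ p, p ∉ Icc a' b' → φ p = 0) → ∫ p, deriv φ p * N p = 0) : N a = N b := by
  have key (a' b' : ℝ) (ha : a < a') (hb : b' < b) (hab' : a' < b') :
      ∃ c, EqOn N (fun _ => c) (Ioo a' b') := by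
    set χ : ℝ → ℝ := fun p => max 0 ((p - a') * (b' - p)) with hχ
    have hχc : Continuous χ := by fun_prop
    have hχ0 : ∀ p, p ∉ Ioo a' b' → χ p = 0 := by
      intro p hp
      rw [hχ]
      refine max_eq_left ?_
      by_contra! hlt
      rcases pos_and_pos_or_neg_and_neg_of_mul_pos hlt with h1 | h1
      · exact hp ⟨by linarith, by linarith⟩
      · linarith
    have hχpos : ∀ p ∈ Ioo a' b', 0 < χ p := fun p hp =>
      lt_max_of_lt_right (mul_pos (by linarith [hp.1]) (by linarith [hp.2]))
    have hcomp (g : ℝ → ℝ) : HasCompactSupport fun p => χ p * g p :=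
      HasCompactSupport.intro (isCompact_Icc (a := a') (b := b')) fun p hp => by
        rw [hχ0 p fun hp' => hp (Ioo_subset_Icc_self hp'), zero_mul]
    have hint (g : ℝ → ℝ) (hg : Continuous g) : Integrable fun p => χ p * g p :=
      (hχc.mul hg).integrable_of_hasCompactSupport (hcomp g)
    have hmid : (a' + b') / 2 ∈ Ioo a' b' := ⟨by linarith, by linarith⟩
    have hpos : 0 < ∫ p, χ p * 1 :=
      (hχc.mul continuous_const).integral_pos_of_hasCompactSupport_nonneg_nonzero (hcomp _)
        (fun p => mul_nonneg (le_max_left _ _) zero_le_one) (x := (a' + b') / 2)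
        (by simpa using (hχpos _ hmid).ne')
    set c := (∫ p, χ p * N p) / ∫ p, χ p * 1 with hc
    refine ⟨c, ?_⟩
    -- Since `c` is the `χ`-weighted mean of `N`, `ψ` has integral zero and its primitive is an
    -- admissible test function. Testing with it yields `∫ χ (N - c)² = 0`.
    set ψ : ℝ → ℝ := fun p => χ p * (N p - c) with hψ
    have hψc : Continuous ψ := by fun_prop
    have hψ0 : ∀ p, p ∉ Ioo a' b' → ψ p = 0 := fun p hp => by simp [hψ, hχ0 p hp]
    have hψint : ∫ p, ψ p = 0 := by
      have : ∀ p, ψ p = χ p * N p - c * (χ p * 1) := fun p => by simp only [hψ]; ring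
      simp only [this]
      rw [integral_sub (hint N hN) ((hint _ continuous_const).const_mul c), integral_const_mul, hc,
        div_mul_cancel₀ _ hpos.ne', sub_self]
    set φ : ℝ → ℝ := fun p => ∫ t in a'..p, ψ t with hφ
    have hφd : ∀ p, HasDerivAt φ (ψ p) p := fun p =>
      intervalIntegral.integral_hasDerivAt_right (hψc.intervalIntegrable _ _)
        (hψc.stronglyMeasurableAtFilter _ _) hψc.continuousAt
    have hφd' : deriv φ = ψ := funext fun p => (hφd p).deriv
    have hφ1 : ContDiff ℝ 1 φ := by
      rw [contDiff_one_iff_deriv, hφd']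
      exact ⟨fun p => (hφd p).differentiableAt, hψc⟩
    have hφ0 : ∀ p, p ∉ Icc a' b' → φ p = 0 := by
      intro p hp
      rcases lt_or_ge p a' with h1 | h1
      · refine intervalIntegral.integral_zero_ae (Eventually.of_forall fun t ht => hψ0 t ?_)
        rw [uIoc_of_ge h1.le] at ht
        exact fun h2 => by linarith [ht.2, h2.1]
      · have h2 : b' < p := by by_contra! h2; exact hp ⟨h1, h2⟩
        rw [hφ]
        simp only
        rw [intervalIntegral.integral_of_le h1, setIntegral_eq_integral_of_forall_compl_eq_zero, hψint]
        intro t ht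
        exact hψ0 t fun h3 => ht ⟨h3.1, h3.2.le.trans h2.le⟩
    have h1 := h a' b' ha hb φ hφ1 hφ0
    rw [hφd'] at h1
    have h2 : ∫ p, χ p * (N p - c) ^ 2 = 0 := by
      have : ∀ p, χ p * (N p - c) ^ 2 = ψ p * N p - c * ψ p := fun p => by simp only [hψ]; ring
      simp only [this]
      rw [integral_sub _ ((hint _ (by fun_prop)).const_mul c), h1, integral_const_mul, hψint]
      · simp
      · have := hint (fun p => (N p - c) * N p) (by fun_prop)
        simpa only [hψ, mul_assoc] using this
    intro p hp
    by_contra hne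
    have : 0 < ∫ p, χ p * (N p - c) ^ 2 :=
      (hχc.mul (by fun_prop)).integral_pos_of_hasCompactSupport_nonneg_nonzero (hcomp _)
        (fun p => mul_nonneg (le_max_left _ _) (sq_nonneg _)) (x := p)
        (mul_ne_zero (hχpos p hp).ne' (pow_ne_zero 2 (sub_ne_zero.2 hne)))
    exact this.ne' h2
  have hconst : ∀ x ∈ Ioo a b, N x = N ((a + b) / 2) := by
    intro x hx
    set m := (a + b) / 2 with hm
    have hma : a < m := by linarith
    have hmb : m < b := by linarith
    obtain ⟨c, hc⟩ := key ((a + min x m) / 2) ((b + max x m) / 2)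
      (by linarith [lt_min hx.1 hma]) (by linarith [max_lt hx.2 hmb])
      (by linarith [min_le_max (a := x) (b := m)])
    have hxm (y : ℝ) (h1 : min x m ≤ y) (h2 : y ≤ max x m) : N y = c :=
      hc ⟨by linarith [lt_min hx.1 hma], by linarith [max_lt hx.2 hmb]⟩
    rw [hxm x (min_le_left _ _) (le_max_left _ _), hxm m (min_le_right _ _) (le_max_right _ _)]
  have hcl : EqOn N (fun _ => N ((a + b) / 2)) (closure (Ioo a b)) :=
    EqOn.closure hconst hN continuous_const
  rw [closure_Ioo hab.ne] at hcl
  exact (hcl (left_mem_Icc.2 hab.le)).trans (hcl (right_mem_Icc.2 hab.le)).symm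

/-! ### Induction on the order of the moment -/

/-- The point is that no order above `k` appears. For `k = 0` the truncated `k - 1` is harmless
because its coefficient is zero. -/
theorem hasDerivAt_pow_mul_exp (lam : ℝ) (k : ℕ) (u : ℝ) :
    HasDerivAt (fun u => u ^ k * Real.exp (-(lam * u)))
      (k * (u ^ (k - 1) * Real.exp (-(lam * u))) - lam * (u ^ k * Real.exp (-(lam * u)))) u := by
  have h1 : HasDerivAt (fun u : ℝ => Real.exp (-(lam * u))) (Real.exp (-(lam * u)) * -lam) u := by
    simpa using (((hasDerivAt_id u).const_mul lam).neg).exp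
  convert! (hasDerivAt_pow k u).mul h1 using 1
  ring

theorem radonMoment_eq (lam : ℝ) (k : ℕ) (f : Plane → ℝ) (ω : Plane) (p : ℝ) :
    radonMoment lam k f ω p = ∫ u, u ^ k * Real.exp (-(lam * u)) * f (pt ω p u) := by
  simp only [radonMoment, mul_assoc]

/-- If all moments of order at most `k` vanish, the moment of order `k + 1` is constant along
families of parallel lines. -/
theorem radonMoment_succ_eq {lam : ℝ} {K Ω : Set Plane} (hK : Convex ℝ K)
    (hΩsphere : Ω ⊆ Metric.sphere (0 : Plane) 1) (hΩ : Preperfect Ω)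
    (hΩK : ∀ p : ℝ, Preperfect {ω ∈ Ω | p ∈ avoiding K ω}) {f : Plane → ℝ} (hf : Continuous f)
    {k : ℕ} (hm : ∀ j ≤ k, ∀ ω ∈ Ω, ∀ p ∈ avoiding K ω, radonMoment lam j f ω p = 0)
    {ω₀ : Plane} (h₀ : ω₀ ∈ Ω) (hdec : RapidDecay lam K Ω (fun _ x => f x) ω₀) {a b : ℝ}
    (hab : a ≤ b) (hsub : Icc a b ⊆ avoiding K ω₀) :
    radonMoment lam (k + 1) f ω₀ a = radonMoment lam (k + 1) f ω₀ b := by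
  rcases hab.eq_or_lt with rfl | hlt
  · rfl
  obtain ⟨ε, hε, C, hC⟩ := exists_weightBound hf hdec hsub (k + 2)
  set S := {ω ∈ Ω | dist ω ω₀ < ε ∧ Icc a b ⊆ avoiding K ω} with hS
  have hS₀ : ω₀ ∈ S := ⟨h₀, by simpa using hε, hsub⟩
  have hacc : AccPt ω₀ (𝓟 S) := by
    refine ((accPt_strip hK hΩ hΩK h₀ hab hsub).nhds_inter (Metric.ball_mem_nhds ω₀ hε)).mono
      (principal_mono.2 ?_)
    rintro ω ⟨h1, h2, h3⟩
    exact ⟨h2, h1, h3⟩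
  set w : ℕ → ℝ → ℝ := fun j u => u ^ j * Real.exp (-(lam * u)) with hw
  have hwc (j : ℕ) : Continuous (w j) := by fun_prop
  have hwA (j : ℕ) (u : ℝ) : |w j u| ≤ weight lam j u := abs_pow_mul_exp_le_weight lam j u
  have hwi (j : ℕ) (hj : j ≤ k + 2) (ω : Plane) (hω : ω ∈ S) (p : ℝ) (hp : p ∈ Icc a b) :
      Integrable fun u => w j u * f (pt ω p u) :=
    (hC.integrable_of_abs_le hf (hwc j) zero_le_one
      (fun u => by rw [one_mul]; exact (hwA j u).trans (weight_mono lam hj u)) hω hp).1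
  have hw0 (j : ℕ) (hj : j ≤ k) (ω : Plane) (hω : ω ∈ S) (p : ℝ) (hp : p ∈ Icc a b) :
      ∫ u, w j u * f (pt ω p u) = 0 := by
    rw [← radonMoment_eq]; exact hm j hj ω hω.1 p (hω.2.2 hp)
  have hmom (p : ℝ) : radonMoment lam (k + 1) f ω₀ p = ∫ u, u * w k u * f (pt ω₀ p u) := by
    rw [radonMoment_eq]; congr 1; ext u; simp only [hw]; ring
  have hcont : ContinuousOn (fun p => radonMoment lam (k + 1) f ω₀ p) (Icc a b) := by
    simp only [hmom]
    refine continuousOn_integral_line hf hS₀ (m := k + 1) hC (by fun_prop) zero_le_one fun u => ?_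
    have : u * w k u = w (k + 1) u := by simp only [hw]; ring
    rw [this, one_mul]
    exact hwA _ u
  -- The moment is controlled only on `[a, b]`, so it is extended by its end values; `deriv φ`
  -- vanishes outside, and the integrals do not see the extension.
  have key := eq_of_integral_deriv_mul_eq_zero
    (N := IccExtend hab ((Icc a b).domRestrict fun p => radonMoment lam (k + 1) f ω₀ p))
    (continuousOn_iff_continuous_domRestrict.1 hcont).Icc_extend' hlt ?_
  · simpa using key
  intro a' b' ha hb φ hφ hφ0
  have hmain := integral_deriv_mul_moment_eq_zero hf (fun ω hω => hΩsphere hω.1) hS₀ hacc ha hb hab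
    hC hφ hφ0 (A := k + |lam| + 1) (w := w k) (by positivity) (hasDerivAt_pow_mul_exp lam k)
    (by fun_prop)
    (fun u => (hwA k u).trans (le_mul_of_one_le_left (weight_nonneg _ _ _)
      (by have := abs_nonneg lam; have : (0 : ℝ) ≤ k := Nat.cast_nonneg k; linarith)))
    (fun u => ?_) (hw0 k le_rfl) (fun p hp => ?_)
  · rw [← hmain]
    congr 1
    ext p
    by_cases hp : p ∈ Icc a b
    · rw [IccExtend_of_mem _ _ hp, domRestrict_apply, hmom]
    · have : φ =ᶠ[𝓝 p] fun _ => 0 := by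
        filter_upwards [isClosed_Icc.isOpen_compl.mem_nhds hp] with q hq
        exact hφ0 q fun h => hq (Icc_subset_Icc ha.le hb.le h)
      rw [this.deriv_eq, deriv_const, zero_mul, zero_mul]
  · have hW := weight_nonneg lam k u
    calc _ ≤ |(k : ℝ) * w (k - 1) u| + |lam * w k u| := abs_sub _ _
      _ = k * |w (k - 1) u| + |lam| * |w k u| := by rw [abs_mul (k : ℝ), abs_mul lam, Nat.abs_cast]
      _ ≤ k * weight lam k u + |lam| * weight lam k u := by
          gcongr
          · exact (hwA _ u).trans (weight_mono lam (Nat.sub_le k 1) u)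
          · exact hwA k u
      _ ≤ _ := by linarith
  · have e (u : ℝ) : (k * (u ^ (k - 1) * Real.exp (-(lam * u))) -
        lam * (u ^ k * Real.exp (-(lam * u)))) * f (pt ω₀ p u) =
        k * (w (k - 1) u * f (pt ω₀ p u)) - lam * (w k u * f (pt ω₀ p u)) := by
      simp only [hw]; ring
    simp only [e]
    rw [integral_sub ((hwi _ (by omega) ω₀ hS₀ p hp).const_mul _)
      ((hwi _ (by omega) ω₀ hS₀ p hp).const_mul _), integral_const_mul, integral_const_mul,
      hw0 _ (by omega) ω₀ hS₀ p hp, hw0 _ le_rfl ω₀ hS₀ p hp]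
    simp

/-- The induction runs over all directions of `Ω` at once, because the step at one direction
differentiates through its neighbours. -/
theorem radonMoment_eq_zero {lam : ℝ} {K Ω : Set Plane} (hK : Convex ℝ K)
    (hΩsphere : Ω ⊆ Metric.sphere (0 : Plane) 1) (hΩ : Preperfect Ω)
    (hΩK : ∀ p : ℝ, Preperfect {ω ∈ Ω | p ∈ avoiding K ω}) {f : Plane → ℝ} (hf : Continuous f)
    (hdecay : ∀ ω₀ ∈ Ω, DecayClass lam K Ω f ω₀)
    (hR : ∀ ω ∈ Ω, ∀ p : ℝ, Disjoint (line ω p) K → radon lam f ω p = 0) (k : ℕ) :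
    ∀ j ≤ k, ∀ ω ∈ Ω, ∀ p ∈ avoiding K ω, radonMoment lam j f ω p = 0 := by
  induction k with
  | zero =>
    intro j hj ω hω p hp
    obtain rfl : j = 0 := by omega
    simpa [radonMoment, radon] using hR ω hω p hp
  | succ k ih =>
    intro j hj ω hω p hp
    rcases Nat.le_succ_iff.1 hj with hj | rfl
    · exact ih j hj ω hω p hp
    have hconst (q : ℝ) (hq : uIcc p q ⊆ avoiding K ω) :
        radonMoment lam (k + 1) f ω p = radonMoment lam (k + 1) f ω q := by
      rcases le_total p q with h | h
      · rw [uIcc_of_le h] at hq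
        exact radonMoment_succ_eq hK hΩsphere hΩ hΩK hf ih hω (hdecay ω hω).decay h hq
      · rw [uIcc_of_ge h] at hq
        exact (radonMoment_succ_eq hK hΩsphere hΩ hΩK hf ih hω (hdecay ω hω).decay h hq).symm
    rcases (hdecay ω hω).moments p hp (k + 1) with ⟨q, hq, h0⟩ | ⟨q, hq, -, -, h0⟩
    · exact (hconst q hq).trans h0
    · refine tendsto_nhds_unique (tendsto_const_nhds.congr fun i => hconst (q i) (hq i)) h0

end ExpRadon

end

theorem mainTheorem6 (lam : ℝ) (K : Set ExpRadon.Plane) (hKconv : Convex ℝ K)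
    (hKclosed : IsClosed K) (Ω : Set ExpRadon.Plane)
    (hΩsphere : Ω ⊆ Metric.sphere (0 : ExpRadon.Plane) 1) (hΩ : Preperfect Ω)
    (hΩK : ∀ p : ℝ, Preperfect {ω ∈ Ω | p ∈ ExpRadon.avoiding K ω})
    (f : ExpRadon.Plane → ℝ) (hf : Continuous f)
    (hdecay : ∀ ω₀ ∈ Ω, ExpRadon.DecayClass lam K Ω f ω₀)
    (hR : ∀ ω ∈ Ω, ∀ p : ℝ, Disjoint (ExpRadon.line ω p) K → ExpRadon.radon lam f ω p = 0) :
    ∀ x ∈ ExpRadon.sharp K Ω, f x = 0 := by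
  intro x hx
  simp only [ExpRadon.sharp, mem_iUnion] at hx
  obtain ⟨ω, hω, p, hp, hxp⟩ := hx
  have hxp' : inner ℝ x ω = p := hxp
  obtain ⟨μ, hμ, hint⟩ := (hdecay ω hω).exp_decay p hp
  have hc : Continuous fun u => Real.exp (-(lam * u)) * f (ExpRadon.pt ω p u) := by
    have : Continuous fun u => f (ExpRadon.pt ω p u) :=
      hf.comp (ExpRadon.continuous_pt.comp (by fun_prop : Continuous fun u : ℝ => (ω, p, u)))
    exact Continuous.mul (by fun_prop) this
  -- Moment determinacy is applied to `e^{-lam u} f` on the single line through `x`; the exponential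
  -- factor is then cancelled.
  have h0 := ExpRadon.eq_zero_of_moments hc hμ hint
    (fun k => by
      obtain ⟨ε, hε, c, h⟩ := (hdecay ω hω).decay p hp k
      exact (h ω hω (by simpa using hε) p hp (by simpa using hε)).1)
    (fun k => ExpRadon.radonMoment_eq_zero hKconv hΩsphere hΩ hΩK hf hdecay hR k k le_rfl ω hω p hp)
    (inner ℝ x (ExpRadon.perp ω))
  have h1 := (mul_eq_zero.1 h0).resolve_left (Real.exp_pos _).ne'
  rwa [← hxp', ExpRadon.pt_inner (hΩsphere hω)] at h1
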